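/- There are absolute constants $C, D$ such that the following holds for all integers $n\ge 1$ and $k\ge 0$. Let $X$ be an $n$-element set with an unknown total order, accessible only through an oracle that, given two distinct elements $x,y\in X$, answers "$x<y$" or "$x>y$". The same query may be repeated; the oracle may choose its answers adaptively, and at most $k$ of its answers during the whole computation are false, each false answer being counted (also for repeated queries). Then there is an algorithm, i.e. a deterministic adaptive comparison strategy (comparison tree) depending only on $n$ and $k$, which for every total order on $X$ and every such behaviour of the oracle correctly determines both the minimum and the maximum of $X$, using at most $$(k+1+C)\,n + D\,k^3$$ comparisons, counted with multiplicity. -/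

import Mathlib

/-- A deterministic adaptive comparison algorithm on the labelled elements of `X`, as a finite
comparison tree. It either stops and announces `m` as the minimum and `M` as the maximum, or it
asks the oracle to compare two distinct elements `x` and `y`; it continues with `ifLt` if the
oracle says `x < y`, and with `ifGt` if the oracle says `x > y`. The same pair may be queried
any number of times. -/
inductive Strategy (X : Type*) where
  | announce (m M : X) : Strategy X
  | compare (x y : X) (hxy : x ≠ y) (ifLt ifGt : Strategy X) : Strategy X

namespace Strategy

variable {X : Type*}

/-- `T.Run lies queries m M`: if the elements of `X` are ordered by the given linear order, then
there is an execution of the algorithm `T`, against some sequence of oracle answers, in which the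
oracle gives exactly `lies` false answers, exactly `queries` comparisons are made (repeated
queries counted with multiplicity), and `(m, M)` is announced at the end. The oracle is adaptive:
at each query it may answer truthfully or falsely. -/
inductive Run [LinearOrder X] : Strategy X → ℕ → ℕ → X → X → Prop
  | announce (m M : X) : Run (.announce m M) 0 0 m M
  | trueLt {x y : X} {hxy : x ≠ y} {ifLt ifGt : Strategy X} {lies queries : ℕ} {m M : X} :
      x < y → Run ifLt lies queries m M →
      Run (.compare x y hxy ifLt ifGt) lies (queries + 1) m M
  | trueGt {x y : X} {hxy : x ≠ y} {ifLt ifGt : Strategy X} {lies queries : ℕ} {m M : X} :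
      y < x → Run ifGt lies queries m M →
      Run (.compare x y hxy ifLt ifGt) lies (queries + 1) m M
  | falseLt {x y : X} {hxy : x ≠ y} {ifLt ifGt : Strategy X} {lies queries : ℕ} {m M : X} :
      y < x → Run ifLt lies queries m M →
      Run (.compare x y hxy ifLt ifGt) (lies + 1) (queries + 1) m M
  | falseGt {x y : X} {hxy : x ≠ y} {ifLt ifGt : Strategy X} {lies queries : ℕ} {m M : X} :
      x < y → Run ifGt lies queries m M →
      Run (.compare x y hxy ifLt ifGt) (lies + 1) (queries + 1) m M

/-- The algorithm `T` finds both the minimum and the maximum of `X` against `k` lies with at most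
`N` comparisons: for every (unknown) linear order on `X`, every execution in which the oracle lies
at most `k` times makes at most `N` comparisons and announces the true minimum and maximum. -/
def FindsMinMax (T : Strategy X) (k N : ℕ) : Prop :=
  ∀ [LinearOrder X] (lies queries : ℕ) (m M : X),
    T.Run lies queries m M → lies ≤ k → queries ≤ N ∧ (∀ z, m ≤ z) ∧ (∀ z, z ≤ M)

end Strategy

/-! The true minimum can be called larger than something only by a lie, so an element that has "won"
`k + 1` answers is not the minimum, and one that has "lost" `k + 1` is not the maximum. Giving every
element `k + 1` wins and `k + 1` losses takes about `k + 1` answers per element, since each answer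
supplies one win and one loss. This is the main term.

To waste nothing, the elements are cut into groups of size `2 ^ p`, of order `k`, and each group is
sorted. The sorting answers are kept as evidence, and `completion` asks pairs, always in the
predicted direction, that supply the missing wins and losses. The waste is controlled by the number
of sorting answers that cross a cut of the sorted list. The merge sort used here keeps this linear
in the group size (`outcome_sort`), hence at most `k + 1`, so a group costs at most `k + 1` per
element plus `2 * (k + 1)` (`length_completion_le`).

An unexpected answer during completion contradicts the sorted order, so the attempt contains a lie;
it is discarded and the group restarted. At most `k` attempts fail, each costing `O(k ^ 2)`, which
gives the `k ^ 3` term. Each group leaves two candidates, and majority votes of `2 * k + 1` answers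
decide among the `O(1 + n / k)` groups at a cost of `O(n + k)`. -/

/-- A deterministic adaptive computation with a comparison oracle that returns a value. -/
inductive Prog (X α : Type) where
  | ret (a : α) : Prog X α
  | ask (x y : X) (hxy : x ≠ y) (ifLt ifGt : Prog X α) : Prog X α

namespace Prog

variable {X α β : Type}

/-- Run `p`, then continue with its result. -/
def bind : Prog X α → (α → Prog X β) → Prog X β
  | ret a, f => f a
  | ask x y h p q, f => ask x y h (p.bind f) (q.bind f)

/-- `p.Outcome log a`: some sequence of answers makes `p` return `a`; the pairs `(x, y)` in `log`
are the answers `x < y`, in order. -/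
inductive Outcome : Prog X α → List (X × X) → α → Prop
  | ret (a : α) : Outcome (.ret a) [] a
  | lt {x y : X} {h : x ≠ y} {p q : Prog X α} {log : List (X × X)} {a : α} :
      Outcome p log a → Outcome (.ask x y h p q) ((x, y) :: log) a
  | gt {x y : X} {h : x ≠ y} {p q : Prog X α} {log : List (X × X)} {a : α} :
      Outcome q log a → Outcome (.ask x y h p q) ((y, x) :: log) a

theorem outcome_ret {log : List (X × X)} {a b : α} (h : (ret a).Outcome log b) :
    log = [] ∧ b = a := by
  cases h
  exact ⟨rfl, rfl⟩

theorem outcome_bind {p : Prog X α} {f : α → Prog X β} {log : List (X × X)} {b : β}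
    (h : (p.bind f).Outcome log b) :
    ∃ a l₁ l₂, p.Outcome l₁ a ∧ (f a).Outcome l₂ b ∧ log = l₁ ++ l₂ := by
  induction p generalizing log with
  | ret a => exact ⟨a, [], log, .ret a, h, rfl⟩
  | ask x y hxy p q ihp ihq =>
    cases h with
    | lt h =>
      obtain ⟨a, l₁, l₂, h₁, h₂, rfl⟩ := ihp h
      exact ⟨a, _, l₂, .lt h₁, h₂, rfl⟩
    | gt h =>
      obtain ⟨a, l₁, l₂, h₁, h₂, rfl⟩ := ihq h
      exact ⟨a, _, l₂, .gt h₁, h₂, rfl⟩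

/-- Run `p` and return the answers it has received along with its result. -/
def withLog : Prog X α → Prog X (α × List (X × X))
  | ret a => ret (a, [])
  | ask x y h p q =>
    ask x y h (p.withLog.bind fun r => ret (r.1, (x, y) :: r.2))
      (q.withLog.bind fun r => ret (r.1, (y, x) :: r.2))

theorem outcome_withLog {p : Prog X α} {log : List (X × X)} {r : α × List (X × X)}
    (h : p.withLog.Outcome log r) : r.2 = log ∧ p.Outcome log r.1 := by
  induction p generalizing log r with
  | ret a =>
    cases h
    exact ⟨rfl, .ret a⟩
  | ask x y hxy p q ihp ihq =>
    cases h with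
    | lt h =>
      obtain ⟨a, l₁, l₂, h₁, h₂, rfl⟩ := outcome_bind h
      obtain ⟨rfl, rfl⟩ := outcome_ret h₂
      obtain ⟨h₃, h₄⟩ := ihp h₁
      simp only [List.append_nil]
      exact ⟨by rw [h₃], .lt h₄⟩
    | gt h =>
      obtain ⟨a, l₁, l₂, h₁, h₂, rfl⟩ := outcome_bind h
      obtain ⟨rfl, rfl⟩ := outcome_ret h₂
      obtain ⟨h₃, h₄⟩ := ihq h₁
      simp only [List.append_nil]
      exact ⟨by rw [h₃], .gt h₄⟩

/-- The comparison strategy that announces the result of `p`. -/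
def toStrategy : Prog X (X × X) → Strategy X
  | ret a => .announce a.1 a.2
  | ask x y h p q => .compare x y h p.toStrategy q.toStrategy

theorem outcome_of_run [LinearOrder X] {p : Prog X (X × X)} {lies queries : ℕ} {m M : X}
    (h : p.toStrategy.Run lies queries m M) :
    ∃ log, p.Outcome log (m, M) ∧ log.length = queries ∧
      log.countP (fun c => ¬ c.1 < c.2) = lies := by
  induction p generalizing lies queries with
  | ret a =>
    cases h
    exact ⟨[], .ret a, rfl, rfl⟩
  | ask x y hxy p q ihp ihq =>
    cases h with
    | trueLt hlt h =>
      obtain ⟨log, h₁, rfl, rfl⟩ := ihp h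
      exact ⟨_, .lt h₁, rfl, by simp [hlt]⟩
    | trueGt hlt h =>
      obtain ⟨log, h₁, rfl, rfl⟩ := ihq h
      exact ⟨_, .gt h₁, rfl, by simp [hlt]⟩
    | falseLt hlt h =>
      obtain ⟨log, h₁, rfl, rfl⟩ := ihp h
      exact ⟨_, .lt h₁, rfl, by simp [hlt.le]⟩
    | falseGt hlt h =>
      obtain ⟨log, h₁, rfl, rfl⟩ := ihq h
      exact ⟨_, .gt h₁, rfl, by simp [hlt.le]⟩

theorem mem_of_pair_sublist {x y : X} {l : List X} (h : [x, y].Sublist l) : x ∈ l ∧ y ∈ l :=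
  ⟨h.subset (by simp), h.subset (by simp)⟩

variable [DecidableEq X]

/-- Ask whether `x < y`; no query is made if `x = y`. -/
def less (x y : X) : Prog X Bool :=
  if h : x = y then ret false else ask x y h (ret true) (ret false)

theorem outcome_less {x y : X} (hxy : x ≠ y) {log : List (X × X)} {b : Bool}
    (h : (less x y).Outcome log b) :
    b = true ∧ log = [(x, y)] ∨ b = false ∧ log = [(y, x)] := by
  rw [less, dif_neg hxy] at h
  cases h with
  | lt h =>
    obtain ⟨rfl, rfl⟩ := outcome_ret h
    exact .inl ⟨rfl, rfl⟩
  | gt h =>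
    obtain ⟨rfl, rfl⟩ := outcome_ret h
    exact .inr ⟨rfl, rfl⟩

theorem outcome_less_self {x : X} {log : List (X × X)} {b : Bool}
    (h : (less x x).Outcome log b) : log = [] := by
  rw [less, dif_pos rfl] at h
  exact (outcome_ret h).1

/-! ### Merge sort with few answers across any cut. -/

/-- Split the sorted list `B` at the place of `a`, by binary search. -/
def split : ℕ → X → List X → Prog X (List X × List X)
  | 0, _, B => ret ([], B)
  | q + 1, a, B =>
    match B.drop (B.length / 2) with
    | [] => ret ([], B)
    | b :: Q =>
      (less a b).bind fun
        | true => (split q a (B.take (B.length / 2))).bind fun r => ret (r.1, r.2 ++ b :: Q)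
        | false => (split q a Q).bind fun r => ret (B.take (B.length / 2) ++ b :: r.1, r.2)

/-- Merge the sorted lists `A` and `B`: the middle element of `A` is located in `B` by binary
search, and the two sides are merged recursively. -/
def merge : ℕ → ℕ → List X → List X → Prog X (List X)
  | 0, _, _, B => ret B
  | p + 1, q, A, B =>
    match A.drop (A.length / 2) with
    | [] => ret B
    | a :: Q =>
      (split q a B).bind fun r =>
        (merge p q (A.take (A.length / 2)) r.1).bind fun l =>
          (merge p q Q r.2).bind fun u => ret (l ++ a :: u)

/-- Merge sort for lists of length at most `2 ^ p`. -/
def sort : ℕ → List X → Prog X (List X)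
  | 0, l => ret l
  | p + 1, l =>
    (sort p (l.take (2 ^ p))).bind fun A =>
      (sort p (l.drop (2 ^ p))).bind fun B => merge (p + 1) (p + 1) A B

/-- Each query halves the interval still open for `a`, so no answer, even a false one, can conflict
with the final place of `a`. Truth of the few answers spreads to all of `B` by transitivity. -/
theorem outcome_split {a : X} {q : ℕ} {B : List X} (hB : B.length < 2 ^ q) (ha : a ∉ B)
    {log : List (X × X)} {r : List X × List X} (h : (split q a B).Outcome log r) :
    r.1 ++ r.2 = B ∧ log.length ≤ q ∧
      (∀ c ∈ log, (c.1 ∈ r.1 ∧ c.2 = a) ∨ (c.1 = a ∧ c.2 ∈ r.2)) ∧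
      ∀ R : X → X → Prop, (∀ x y z, R x y → R y z → R x z) → B.Pairwise R →
        (∀ c ∈ log, R c.1 c.2) → (∀ b ∈ r.1, R b a) ∧ ∀ b ∈ r.2, R a b := by
  induction q generalizing B log r with
  | zero =>
    obtain ⟨rfl, rfl⟩ := outcome_ret h
    have : B = [] := List.length_eq_zero_iff.1 (by simpa using hB)
    subst this
    simp
  | succ q ih =>
    rw [split] at h
    have hsplit := List.take_append_drop (B.length / 2) B
    have hlen₁ : (B.take (B.length / 2)).length = B.length / 2 := by
      rw [List.length_take]; omega
    have hlen₂ : (B.drop (B.length / 2)).length = B.length - B.length / 2 := List.length_drop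
    rw [pow_succ] at hB
    generalize B.take (B.length / 2) = P at *
    generalize B.drop (B.length / 2) = D at *
    cases D with
    | nil =>
      obtain ⟨rfl, rfl⟩ := outcome_ret h
      have : B = [] := List.length_eq_zero_iff.1 (by simp at hlen₂; omega)
      subst this
      simp
    | cons b Q =>
      obtain ⟨t, l₁, l₂, h₁, h₂, rfl⟩ := outcome_bind h
      rw [List.length_cons] at hlen₂
      have hab : a ≠ b := by
        rintro rfl
        exact ha (by simp [← hsplit])
      rcases outcome_less hab h₁ with ⟨rfl, rfl⟩ | ⟨rfl, rfl⟩
      · obtain ⟨s, l₃, l₄, h₃, h₄, rfl⟩ := outcome_bind h₂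
        obtain ⟨rfl, rfl⟩ := outcome_ret h₄
        obtain ⟨e, hl, hc, hR⟩ := ih (by omega) (fun hm => ha (by simp [← hsplit, hm])) h₃
        refine ⟨by rw [← hsplit, ← e]; simp, by simp; omega, ?_, ?_⟩
        · simp only [List.append_nil, List.singleton_append, List.mem_cons]
          rintro c (rfl | hm)
          · simp
          · rcases hc c hm with h | h
            · exact .inl h
            · exact .inr ⟨h.1, by simp [h.2]⟩
        · intro R htr hs ht
          rw [← hsplit, List.pairwise_append, List.pairwise_cons] at hs
          obtain ⟨hs₁, hs₂⟩ := hR R htr hs.1 fun c hm => ht c (by simp [hm])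
          have hab : R a b := ht (a, b) (by simp)
          refine ⟨hs₁, fun x hx => ?_⟩
          rcases List.mem_append.1 hx with hx | hx
          · exact hs₂ x hx
          · rcases List.mem_cons.1 hx with rfl | hx
            · exact hab
            · exact htr _ _ _ hab (hs.2.1.1 x hx)
      · obtain ⟨s, l₃, l₄, h₃, h₄, rfl⟩ := outcome_bind h₂
        obtain ⟨rfl, rfl⟩ := outcome_ret h₄
        obtain ⟨e, hl, hc, hR⟩ := ih (by omega) (fun hm => ha (by simp [← hsplit, hm])) h₃
        refine ⟨by rw [← hsplit, ← e]; simp, by simp; omega, ?_, ?_⟩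
        · simp only [List.append_nil, List.singleton_append, List.mem_cons]
          rintro c (rfl | hm)
          · simp
          · rcases hc c hm with h | h
            · exact .inl ⟨by simp [h.1], h.2⟩
            · exact .inr h
        · intro R htr hs ht
          rw [← hsplit, List.pairwise_append, List.pairwise_cons] at hs
          obtain ⟨hs₁, hs₂⟩ := hR R htr hs.2.1.2 fun c hm => ht c (by simp [hm])
          have hab : R b a := ht (b, a) (by simp)
          refine ⟨fun x hx => ?_, hs₂⟩
          rcases List.mem_append.1 hx with hx | hx
          · exact htr _ _ _ (hs.2.2 x hx b (by simp)) hab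
          · rcases List.mem_cons.1 hx with rfl | hx
            · exact hab
            · exact hs₁ x hx

/-- The number of answers in `log` from inside `S` to outside `S`. -/
def crossing (S : X → Prop) [DecidablePred S] (log : List (X × X)) : ℕ :=
  log.countP fun c => S c.1 ∧ ¬ S c.2

/-- Here `S` is an initial segment of `l`. If it contains the pivot `a`, the lower part lies inside
`S`; otherwise the upper part lies outside. So only one of the two recursive merges can cross the
cut, and each of the `p` levels adds one binary search of at most `q` answers. -/
theorem outcome_merge {p q : ℕ} {A B : List X} (hA : A.length < 2 ^ p) (hB : B.length < 2 ^ q)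
    (hnd : (A ++ B).Nodup) {log : List (X × X)} {l : List X}
    (h : (merge p q A B).Outcome log l) :
    l.Perm (A ++ B) ∧ A.Sublist l ∧ B.Sublist l ∧ (∀ c ∈ log, [c.1, c.2].Sublist l) ∧
      (∀ (S : X → Prop) [DecidablePred S], l.Pairwise (fun x y => S y → S x) →
        crossing S log ≤ p * q) ∧
      ∀ R : X → X → Prop, (∀ x y z, R x y → R y z → R x z) → A.Pairwise R → B.Pairwise R →
        (∀ c ∈ log, R c.1 c.2) → l.Pairwise R := by
  induction p generalizing A B log l with
  | zero =>
    obtain ⟨rfl, rfl⟩ := outcome_ret h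
    have : A = [] := List.length_eq_zero_iff.1 (by simpa using hA)
    subst this
    simp [crossing]
  | succ p ih =>
    rw [merge] at h
    have hsplit := List.take_append_drop (A.length / 2) A
    have hlen₁ : (A.take (A.length / 2)).length = A.length / 2 := by
      rw [List.length_take]; omega
    have hlen₂ : (A.drop (A.length / 2)).length = A.length - A.length / 2 := List.length_drop
    rw [pow_succ] at hA
    generalize A.take (A.length / 2) = P at *
    generalize A.drop (A.length / 2) = D at *
    cases D with
    | nil =>
      obtain ⟨rfl, rfl⟩ := outcome_ret h
      have : A = [] := List.length_eq_zero_iff.1 (by simp at hlen₂; omega)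
      subst this
      simp [crossing]
    | cons a Q =>
      rw [List.length_cons] at hlen₂
      obtain ⟨⟨B₁, B₂⟩, l₁, k₁, h₁, g₁, rfl⟩ := outcome_bind h
      obtain ⟨lo, l₂, k₂, h₂, g₂, rfl⟩ := outcome_bind g₁
      obtain ⟨up, l₃, k₃, h₃, g₃, rfl⟩ := outcome_bind g₂
      obtain ⟨rfl, rfl⟩ := outcome_ret g₃
      have haB : a ∉ B := by
        intro hm
        rw [← hsplit] at hnd
        exact List.disjoint_of_nodup_append hnd (by simp) hm
      obtain ⟨rfl, hs₁, hs₂, hs₃⟩ := outcome_split hB haB h₁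
      simp only at *
      rw [List.length_append] at hB
      have hnd' : ((P ++ B₁) ++ a :: (Q ++ B₂)).Nodup := by
        refine (List.Perm.nodup_iff (List.perm_iff_count.2 fun x => ?_)).1 hnd
        simp only [← hsplit, List.count_append, List.count_cons]
        omega
      have hnd₁ := (List.nodup_append.1 hnd').1
      have hnd₂ := (List.nodup_cons.1 (List.nodup_append.1 hnd').2.1).2
      obtain ⟨p₁, a₁, b₁, c₁, x₁, t₁⟩ := ih (by omega) (by omega) hnd₁ h₂
      obtain ⟨p₂, a₂, b₂, c₂, x₂, t₂⟩ := ih (by omega) (by omega) hnd₂ h₃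
      subst hsplit
      refine ⟨?_, a₁.append (a₂.cons_cons a), b₁.append (b₂.cons a), ?_, ?_, ?_⟩
      · refine (p₁.append (p₂.cons a)).trans ?_
        refine List.perm_iff_count.2 fun x => ?_
        simp only [List.count_append, List.count_cons]
        omega
      · simp only [List.append_nil, List.mem_append]
        rintro c (hc | hc | hc)
        · rcases hs₂ c hc with ⟨h, e⟩ | ⟨e, h⟩
          · rw [e]
            exact (List.singleton_sublist.2 (b₁.subset h)).append
              (List.singleton_sublist.2 (List.mem_cons_self))
          · rw [e]
            exact ((List.singleton_sublist.2 (b₂.subset h)).cons_cons a).trans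
              (List.sublist_append_right _ _)
        · exact (c₁ c hc).trans (List.sublist_append_left _ _)
        · exact ((c₂ c hc).cons a).trans (List.sublist_append_right _ _)
      · intro S _ hS
        rw [List.pairwise_append, List.pairwise_cons] at hS
        have e₁ : crossing S l₁ ≤ q := List.countP_le_length.trans hs₁
        have e : crossing S (l₁ ++ (l₂ ++ (l₃ ++ []))) =
            crossing S l₁ + (crossing S l₂ + crossing S l₃) := by
          simp [crossing, List.countP_append]
        have e₂ := x₁ S hS.1
        have e₃ := x₂ S hS.2.1.2
        rw [e, Nat.add_mul]
        by_cases ha : S a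
        · have : crossing S l₂ = 0 := by
            refine List.countP_eq_zero.2 fun c hc => ?_
            have := hS.2.2 c.2 (mem_of_pair_sublist (c₁ c hc)).2 a (by simp) ha
            simp [this]
          omega
        · have : crossing S l₃ = 0 := by
            refine List.countP_eq_zero.2 fun c hc => ?_
            have := mt (hS.2.1.1 c.1 (mem_of_pair_sublist (c₂ c hc)).1) ha
            simp [this]
          omega
      · intro R htr hA hB ht
        rw [List.pairwise_append, List.pairwise_cons] at hA
        obtain ⟨u₁, u₂⟩ := hs₃ R htr hB fun c hc => ht c (by simp [hc])
        rw [List.pairwise_append] at hB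
        have v₁ := t₁ R htr hA.1 hB.1 fun c hc => ht c (by simp [hc])
        have v₂ := t₂ R htr hA.2.1.2 hB.2.1 fun c hc => ht c (by simp [hc])
        have w₁ : ∀ x ∈ lo, R x a := fun x hx => by
          rcases List.mem_append.1 (p₁.subset hx) with h | h
          · exact hA.2.2 x h a (by simp)
          · exact u₁ x h
        have w₂ : ∀ x ∈ up, R a x := fun x hx => by
          rcases List.mem_append.1 (p₂.subset hx) with h | h
          · exact hA.2.1.1 x h
          · exact u₂ x h
        rw [List.pairwise_append, List.pairwise_cons]
        refine ⟨v₁, ⟨w₂, v₂⟩, fun x hx y hy => ?_⟩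
        rcases List.mem_cons.1 hy with rfl | hy
        · exact w₁ x hx
        · exact htr _ _ _ (w₁ x hx) (w₂ y hy)

/-- The crossing numbers satisfy `c (p + 1) ≤ 2 * c p + (p + 1) ^ 2` with `c 0 = 0`; the bound is
the exact solution of this recurrence. The output extends all received answers, true or false. -/
theorem outcome_sort {p : ℕ} {l : List X} (hl : l.length ≤ 2 ^ p) (hnd : l.Nodup)
    {log : List (X × X)} {out : List X} (h : (sort p l).Outcome log out) :
    out.Perm l ∧ (∀ c ∈ log, [c.1, c.2].Sublist out) ∧
      (∀ (S : X → Prop) [DecidablePred S], out.Pairwise (fun x y => S y → S x) →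
        crossing S log + (p ^ 2 + 4 * p + 6) ≤ 6 * 2 ^ p) ∧
      ∀ R : X → X → Prop, (∀ x y z, R x y → R y z → R x z) →
        (∀ c ∈ log, R c.1 c.2) → out.Pairwise R := by
  induction p generalizing l log out with
  | zero =>
    obtain ⟨rfl, rfl⟩ := outcome_ret h
    refine ⟨.refl _, by simp, by simp [crossing], fun R _ _ => ?_⟩
    match out, hl with
    | [], _ => simp
    | [x], _ => simp
  | succ p ih =>
    obtain ⟨A, l₁, l', h₁, h', rfl⟩ := outcome_bind h
    obtain ⟨B, l₂, l₃, h₂, h₃, rfl⟩ := outcome_bind h'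
    have hnd' := hnd
    rw [← List.take_append_drop (2 ^ p) l] at hnd'
    have hp : 2 ^ (p + 1) = 2 * 2 ^ p := by ring
    have hpos : 0 < 2 ^ p := by positivity
    obtain ⟨p₁, c₁, x₁, t₁⟩ := ih (by simp) (List.nodup_append.1 hnd').1 h₁
    obtain ⟨p₂, c₂, x₂, t₂⟩ := ih (by rw [List.length_drop]; omega)
      (List.nodup_append.1 hnd').2.1 h₂
    have hperm : (A ++ B).Perm l := by
      conv_rhs => rw [← List.take_append_drop (2 ^ p) l]
      exact p₁.append p₂
    have hA : A.length < 2 ^ (p + 1) := by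
      rw [p₁.length_eq, List.length_take]; omega
    have hB : B.length < 2 ^ (p + 1) := by
      rw [p₂.length_eq, List.length_drop]; omega
    obtain ⟨p₃, a₃, b₃, c₃, x₃, t₃⟩ := outcome_merge hA hB (hperm.nodup_iff.2 hnd) h₃
    refine ⟨p₃.trans hperm, ?_, ?_, ?_⟩
    · simp only [List.mem_append]
      rintro c (hc | hc | hc)
      · exact (c₁ c hc).trans a₃
      · exact (c₂ c hc).trans b₃
      · exact c₃ c hc
    · intro S _ hS
      have e : crossing S (l₁ ++ (l₂ ++ l₃)) =
          crossing S l₁ + (crossing S l₂ + crossing S l₃) := by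
        simp [crossing, List.countP_append]
      have e₁ := x₁ S (hS.sublist a₃)
      have e₂ := x₂ S (hS.sublist b₃)
      have e₃ := x₃ S hS
      rw [e, hp]
      nlinarith
    · intro R htr ht
      exact t₃ R htr (t₁ R htr fun c hc => ht c (by simp [hc]))
        (t₂ R htr fun c hc => ht c (by simp [hc])) fun c hc => ht c (by simp [hc])

/-! ### Counting wins and losses, and matching the missing ones. -/

/-- The number of answers in `log` of the form `y < x`. -/
def wins (log : List (X × X)) (x : X) : ℕ := log.countP fun c => c.2 = x

/-- The number of answers in `log` of the form `x < y`. -/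
def losses (log : List (X × X)) (x : X) : ℕ := log.countP fun c => c.1 = x

theorem wins_append (l₁ l₂ : List (X × X)) (x : X) :
    wins (l₁ ++ l₂) x = wins l₁ x + wins l₂ x := List.countP_append

theorem losses_append (l₁ l₂ : List (X × X)) (x : X) :
    losses (l₁ ++ l₂) x = losses l₁ x + losses l₂ x := List.countP_append

theorem wins_map (l : List X) (x y : X) :
    wins (l.map (·, y)) x = if y = x then l.length else 0 := by
  induction l with
  | nil => simp [wins]
  | cons z l ih =>
    rw [wins] at ih
    rw [List.map_cons, wins, List.countP_cons, ih]
    by_cases h : y = x <;> simp [h]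

theorem losses_map (l : List X) (x y : X) : losses (l.map (·, y)) x = l.count x := by
  induction l with
  | nil => simp [losses]
  | cons z l ih =>
    rw [losses] at ih
    rw [List.map_cons, losses, List.countP_cons, ih, List.count_cons]
    simp

/-- Pair up demands along a list: each `x` in the list needs `need x` smaller partners, which are
taken from the front of a queue, and then enters the queue `lose x` times. The result consists of
the pairs, the unmet needs, and the final queue. -/
def pairUp (need lose : X → ℕ) : List X → List X → List (X × X) × List X × List X
  | pool, [] => ([], [], pool)
  | pool, x :: xs =>
    let r := pairUp need lose (pool.drop (need x) ++ List.replicate (lose x) x) xs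
    ((pool.take (need x)).map (·, x) ++ r.1,
      List.replicate (need x - pool.length) x ++ r.2.1, r.2.2)

omit [DecidableEq X] in
theorem pairUp_rel {need lose : X → ℕ} {R : X → X → Prop} {l pool : List X} (hl : l.Pairwise R)
    (hpool : ∀ a ∈ pool, ∀ b ∈ l, R a b) :
    ∀ c ∈ (pairUp need lose pool l).1, R c.1 c.2 := by
  induction l generalizing pool with
  | nil => simp [pairUp]
  | cons x xs ih =>
    rw [List.pairwise_cons] at hl
    simp only [pairUp, List.mem_append, List.mem_map]
    rintro c (⟨a, ha, rfl⟩ | hc)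
    · exact hpool a (List.mem_of_mem_take ha) x (by simp)
    · refine ih hl.2 ?_ c hc
      intro a ha b hb
      rcases List.mem_append.1 ha with ha | ha
      · exact hpool a (List.mem_of_mem_drop ha) b (by simp [hb])
      · rw [List.eq_of_mem_replicate ha]
        exact hl.1 b hb

omit [DecidableEq X] in
theorem pairUp_mem {need lose : X → ℕ} {l pool : List X} :
    (∀ x ∈ (pairUp need lose pool l).2.1, x ∈ l) ∧
      ∀ x ∈ (pairUp need lose pool l).2.2, x ∈ pool ∨ x ∈ l := by
  induction l generalizing pool with
  | nil => simp [pairUp]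
  | cons y ys ih =>
    obtain ⟨h₁, h₂⟩ := @ih (pool.drop (need y) ++ List.replicate (lose y) y)
    simp only [pairUp, List.mem_append, List.mem_cons]
    refine ⟨?_, fun x hx => ?_⟩
    · rintro x (hx | hx)
      · exact .inl (List.eq_of_mem_replicate hx)
      · exact .inr (h₁ x hx)
    · rcases h₂ x hx with h | h
      · rcases List.mem_append.1 h with h | h
        · exact .inl (List.mem_of_mem_drop h)
        · exact .inr (.inl (List.eq_of_mem_replicate h))
      · exact .inr (.inr h)

theorem pairUp_wins {need lose : X → ℕ} {l pool : List X} (hl : l.Nodup) {x : X} (hx : x ∈ l) :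
    wins (pairUp need lose pool l).1 x + (pairUp need lose pool l).2.1.count x = need x := by
  induction l generalizing pool with
  | nil => simp at hx
  | cons y ys ih =>
    rw [List.nodup_cons] at hl
    simp only [pairUp, wins_append, List.count_append, List.count_replicate]
    by_cases hxy : x = y
    · subst hxy
      have h₁ : (pairUp need lose (pool.drop (need x) ++ List.replicate (lose x) x) ys).2.1.count
          x = 0 := List.count_eq_zero.2 fun h => hl.1 (pairUp_mem.1 x h)
      have h₂ : wins (pairUp need lose (pool.drop (need x) ++ List.replicate (lose x) x) ys).1 x
          = 0 := by
        refine List.countP_eq_zero.2 fun c hc => ?_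
        -- A relation that ignores its first argument shows that `x` is never a winner in the later
        -- pairs.
        have := pairUp_rel (R := fun _ b => b ≠ x) ?_ ?_ c hc
        · simpa using this
        · exact List.Pairwise.imp_of_mem (fun _ hb _ e => hl.1 (e ▸ hb)) hl.2
        · exact fun _ _ b hb e => hl.1 (e ▸ hb)
      rw [h₁, h₂, wins_map, if_pos rfl, List.length_take, beq_self_eq_true, if_pos rfl]
      omega
    · have h := @ih (pool.drop (need y) ++ List.replicate (lose y) y) hl.2
        ((List.mem_cons.1 hx).resolve_left hxy)
      rw [wins_map, if_neg (Ne.symm hxy), if_neg (by simpa using Ne.symm hxy)]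
      omega

theorem pairUp_losses {need lose : X → ℕ} {l pool : List X} (x : X) :
    losses (pairUp need lose pool l).1 x + (pairUp need lose pool l).2.2.count x =
      pool.count x + l.count x * lose x := by
  induction l generalizing pool with
  | nil => simp [pairUp, losses]
  | cons y ys ih =>
    have h := @ih (pool.drop (need y) ++ List.replicate (lose y) y)
    have e' := List.count_append (a := x) (l₁ := pool.take (need y)) (l₂ := pool.drop (need y))
    rw [List.take_append_drop] at e'
    rw [List.count_append, List.count_replicate] at h
    simp only [pairUp, losses_append, losses_map, List.count_cons]
    by_cases hxy : y = x
    · subst hxy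
      simp only [beq_self_eq_true, if_true] at h ⊢
      rw [add_mul]
      omega
    · simp only [beq_iff_eq, hxy, if_false] at h ⊢
      rw [add_zero]
      omega

omit [DecidableEq X] in
theorem pairUp_length {need lose : X → ℕ} {l pool : List X} :
    (pairUp need lose pool l).1.length + (pairUp need lose pool l).2.1.length =
        (l.map need).sum ∧
      (pairUp need lose pool l).1.length + (pairUp need lose pool l).2.2.length =
        pool.length + (l.map lose).sum := by
  induction l generalizing pool with
  | nil => simp [pairUp]
  | cons y ys ih =>
    have h := @ih (pool.drop (need y) ++ List.replicate (lose y) y)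
    simp only [List.length_append, List.length_drop, List.length_replicate] at h
    simp only [pairUp, List.length_append, List.length_map, List.length_take,
      List.length_replicate, List.map_cons, List.sum_cons]
    omega

-- A need goes unmet only when the queue has run empty, so the total unmet need is the largest
-- deficit of supply over a prefix of the list.
omit [DecidableEq X] in
theorem pairUp_unmet_le {need lose : X → ℕ} {l pool : List X} {b : ℕ}
    (h : ∀ l₁ x l₂, l = l₁ ++ x :: l₂ →
      (l₁.map need).sum + need x ≤ pool.length + (l₁.map lose).sum + b) :
    (pairUp need lose pool l).2.1.length ≤ b := by
  induction l generalizing pool b with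
  | nil => simp [pairUp]
  | cons y ys ih =>
    have h₀ := h [] y ys rfl
    simp only [List.map_nil, List.sum_nil] at h₀
    simp only [pairUp, List.length_append, List.length_replicate]
    have := @ih (pool.drop (need y) ++ List.replicate (lose y) y) (b - (need y - pool.length)) ?_
    · omega
    · intro l₁ x l₂ e
      have h₁ := h (y :: l₁) x l₂ (by rw [e]; rfl)
      simp only [List.map_cons, List.sum_cons] at h₁
      simp only [List.length_append, List.length_drop, List.length_replicate]
      omega

theorem sum_map_indicator {l : List X} (hl : l.Nodup) (a : X) :
    (l.map fun x => if a = x then 1 else 0).sum = if a ∈ l then 1 else 0 := by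
  induction l with
  | nil => simp
  | cons y l ih =>
    rw [List.nodup_cons] at hl
    rw [List.map_cons, List.sum_cons, ih hl.2]
    by_cases h : a = y
    · subst h
      simp [hl.1]
    · simp [h]

theorem sum_wins {l : List X} (hl : l.Nodup) (log : List (X × X)) :
    (l.map (wins log)).sum = log.countP fun c => c.2 ∈ l := by
  induction log with
  | nil => simp [show wins ([] : List (X × X)) = fun _ => 0 from rfl]
  | cons c log ih =>
    have : wins (c :: log) = fun x => wins log x + if c.2 = x then 1 else 0 := by
      funext x
      simp [wins, List.countP_cons]
    rw [this, List.sum_map_add, ih, List.countP_cons, sum_map_indicator hl]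
    simp

theorem sum_losses {l : List X} (hl : l.Nodup) (log : List (X × X)) :
    (l.map (losses log)).sum = log.countP fun c => c.1 ∈ l := by
  induction log with
  | nil => simp [show losses ([] : List (X × X)) = fun _ => 0 from rfl]
  | cons c log ih =>
    have : losses (c :: log) = fun x => losses log x + if c.1 = x then 1 else 0 := by
      funext x
      simp [losses, List.countP_cons]
    rw [this, List.sum_map_add, ih, List.countP_cons, sum_map_indicator hl]
    simp

theorem wins_map_left (l : List X) (x y : X) : wins (l.map (y, ·)) x = l.count x := by
  induction l with
  | nil => simp [wins]
  | cons z l ih =>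
    rw [wins] at ih
    rw [List.map_cons, wins, List.countP_cons, ih, List.count_cons]
    simp

omit [DecidableEq X] in
theorem pairwise_mem_of_nodup_append {l₁ l₂ : List X} (h : (l₁ ++ l₂).Nodup) :
    (l₁ ++ l₂).Pairwise fun a b => b ∈ l₁ → a ∈ l₁ := by
  have hd := List.disjoint_of_nodup_append h
  rw [List.pairwise_append]
  refine ⟨?_, ?_, fun a ha b _ _ => ha⟩
  · exact List.Pairwise.imp_of_mem (fun ha _ _ _ => ha) (List.nodup_append.1 h).1
  · exact List.Pairwise.imp_of_mem (fun _ hb _ hb' => (hd hb' hb).elim) (List.nodup_append.1 h).2.1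

/-- Only an answer whose loser is in `l` and whose winner is outside counts on the left without
counting as a win. -/
theorem sum_losses_le {l : List X} (hl : l.Nodup) (log : List (X × X)) :
    (l.map (losses log)).sum ≤ (l.map (wins log)).sum + crossing (· ∈ l) log := by
  rw [sum_losses hl, sum_wins hl, crossing]
  induction log with
  | nil => simp
  | cons c log ih =>
    simp only [List.countP_cons]
    by_cases h₁ : c.1 ∈ l <;> by_cases h₂ : c.2 ∈ l <;> simp [h₁, h₂] at ih ⊢ <;> omega

/-- All wins of `x` are over elements preceding it, so they cross the cut just before `x`. -/
theorem wins_le_crossing {l₁ l₂ : List X} {x : X} (h : (l₁ ++ x :: l₂).Nodup)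
    {log : List (X × X)} (hlog : ∀ c ∈ log, [c.1, c.2].Sublist (l₁ ++ x :: l₂)) :
    wins log x ≤ crossing (· ∈ l₁) log := by
  refine List.countP_mono_left fun c hc hx => ?_
  have hs := hlog c hc
  have hne : c.1 ≠ c.2 := by simpa using hs.nodup h
  have hx : c.2 = x := by simpa using hx
  have hx₁ : x ∉ l₁ := fun hm => List.disjoint_of_nodup_append h hm (by simp)
  rw [List.append_cons] at h hs
  have := (pairwise_mem_of_nodup_append h).sublist hs
  simp only [List.pairwise_cons, List.mem_singleton, forall_eq, hx] at this
  have := this.1 (by simp)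
  rw [hx] at hne
  simpa [hx, hx₁, hne] using this

theorem losses_le_crossing {l₁ l₂ : List X} {x : X} (h : (l₁ ++ x :: l₂).Nodup)
    {log : List (X × X)} (hlog : ∀ c ∈ log, [c.1, c.2].Sublist (l₁ ++ x :: l₂)) :
    losses log x ≤ crossing (· ∈ l₁ ++ [x]) log := by
  refine List.countP_mono_left fun c hc hx => ?_
  have hs := hlog c hc
  have hne : c.1 ≠ c.2 := by simpa using hs.nodup h
  have hx : c.1 = x := by simpa using hx
  have hx₁ : x ∉ l₁ := fun hm => List.disjoint_of_nodup_append h hm (by simp)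
  have := (pairwise_mem_of_nodup_append h).sublist hs
  simp only [List.pairwise_cons, List.mem_singleton, forall_eq, hx] at this
  rw [hx] at hne
  simp only [hx, List.mem_append, List.mem_singleton, or_true, true_and, decide_eq_true_eq]
  rintro (hm | rfl)
  · exact hx₁ (this.1 hm)
  · exact hne rfl

/-! ### Completing the evidence inside one group. -/

/-- The pairs whose comparison completes `log` to `k + 1` answers against each element of the
sorted list `l` being the minimum, except for the first element, and against each being the
maximum, except for the last. -/
def completion (k : ℕ) (d : X) (log : List (X × X)) (l : List X) : List (X × X) :=
  let r := pairUp (fun x => k + 1 - wins log x) (fun x => k + 1 - losses log x) [] l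
  r.1 ++ (((r.2.1.filter (· ≠ l.headD d)).map (l.headD d, ·)) ++
    (r.2.2.filter (· ≠ l.reverse.headD d)).map (·, l.reverse.headD d))

omit [DecidableEq X] in
theorem rel_headD {R : X → X → Prop} {l : List X} (h : l.Pairwise R) {d x : X} (hx : x ∈ l)
    (hne : x ≠ l.headD d) : R (l.headD d) x := by
  cases l with
  | nil => simp at hx
  | cons a l => exact (List.pairwise_cons.1 h).1 x ((List.mem_cons.1 hx).resolve_left hne)

theorem completion_rel {k : ℕ} {d : X} {log : List (X × X)} {l : List X} {R : X → X → Prop}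
    (h : l.Pairwise R) : ∀ c ∈ completion k d log l, R c.1 c.2 := by
  intro c hc
  simp only [completion, List.mem_append, List.mem_map, List.mem_filter, decide_eq_true_eq] at hc
  rcases hc with hc | ⟨x, ⟨hx, hne⟩, rfl⟩ | ⟨x, ⟨hx, hne⟩, rfl⟩
  · exact pairUp_rel h (by simp) c hc
  · exact rel_headD h (pairUp_mem.1 x hx) hne
  · have := (pairUp_mem.2 x hx).resolve_left (by simp)
    exact rel_headD (R := fun a b => R b a) (List.pairwise_reverse.2 h)
      (List.mem_reverse.2 this) hne

theorem completion_ne {k : ℕ} {d : X} {log : List (X × X)} {l : List X} (h : l.Nodup) :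
    ∀ c ∈ completion k d log l, c.1 ≠ c.2 := completion_rel h

theorem wins_completion {k : ℕ} {d : X} {log : List (X × X)} {l : List X} (h : l.Nodup) {x : X}
    (hx : x ∈ l) (hne : x ≠ l.headD d) : k + 1 ≤ wins (log ++ completion k d log l) x := by
  have := pairUp_wins (need := fun x => k + 1 - wins log x)
    (lose := fun x => k + 1 - losses log x) (pool := []) h hx
  simp only [completion, wins_append, wins_map_left]
  rw [List.count_filter (by simpa using hne)]
  omega

theorem losses_completion {k : ℕ} {d : X} {log : List (X × X)} {l : List X} (h : l.Nodup) {x : X}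
    (hx : x ∈ l) (hne : x ≠ l.reverse.headD d) :
    k + 1 ≤ losses (log ++ completion k d log l) x := by
  have := pairUp_losses (need := fun x => k + 1 - wins log x)
    (lose := fun x => k + 1 - losses log x) (pool := []) (l := l) x
  rw [List.count_eq_one_of_mem h hx] at this
  simp only [completion, losses_append, losses_map]
  rw [List.count_filter (by simpa using hne)]
  simp only [List.count_nil] at this
  omega

/-- Sorting answers, matched pairs and unmet needs together use exactly `k + 1` wins per element.
The only excess is the final queue, which is as long as the list of unmet needs because wins and
losses balance. -/
theorem length_completion_le {k b : ℕ} {d : X} {log : List (X × X)} {l : List X} (h : l.Nodup)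
    (hb : b ≤ k + 1) (hlog : ∀ c ∈ log, [c.1, c.2].Sublist l)
    (hcross : ∀ (S : X → Prop) [DecidablePred S], l.Pairwise (fun x y => S y → S x) →
      crossing S log ≤ b) :
    log.length + (completion k d log l).length ≤ (k + 1) * l.length + (b + k + 1) := by
  have hwins : ∀ l₁ x l₂, l = l₁ ++ x :: l₂ → wins log x ≤ b := by
    rintro l₁ x l₂ rfl
    exact (wins_le_crossing h hlog).trans (hcross _ (pairwise_mem_of_nodup_append h))
  have hlosses : ∀ l₁ x l₂, l = l₁ ++ x :: l₂ → losses log x ≤ b := by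
    rintro l₁ x l₂ rfl
    refine (losses_le_crossing h hlog).trans (hcross (· ∈ l₁ ++ [x]) ?_)
    have h' := h
    rw [List.append_cons] at h'
    simpa only [← List.append_cons] using pairwise_mem_of_nodup_append h'
  have hneed : ∀ l' : List X, (∀ x ∈ l', wins log x ≤ b) →
      (l'.map fun x => k + 1 - wins log x).sum + (l'.map (wins log)).sum = (k + 1) * l'.length := by
    intro l' hl'
    -- Since the wins are at most `b ≤ k + 1`, the subtraction is not truncated: no sorting answer
    -- is surplus.
    rw [← List.sum_map_add, List.map_congr_left (g := fun _ => k + 1)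
      (fun x hx => by have := hl' x hx; omega)]
    simp [mul_comm]
  have hlose : ∀ l' : List X, (∀ x ∈ l', losses log x ≤ b) →
      (l'.map fun x => k + 1 - losses log x).sum + (l'.map (losses log)).sum =
        (k + 1) * l'.length := by
    intro l' hl'
    rw [← List.sum_map_add, List.map_congr_left (g := fun _ => k + 1)
      (fun x hx => by have := hl' x hx; omega)]
    simp [mul_comm]
  have hwins' : ∀ x ∈ l, wins log x ≤ b := fun x hx => by
    obtain ⟨l₁, l₂, e⟩ := List.append_of_mem hx
    exact hwins l₁ x l₂ e
  have hlosses' : ∀ x ∈ l, losses log x ≤ b := fun x hx => by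
    obtain ⟨l₁, l₂, e⟩ := List.append_of_mem hx
    exact hlosses l₁ x l₂ e
  -- The needs of `l₁` exceed its supply by at most its crossing number, which is at most `b`; the
  -- need of `x` itself adds at most `k + 1`.
  have hunmet := pairUp_unmet_le (need := fun x => k + 1 - wins log x)
    (lose := fun x => k + 1 - losses log x) (pool := []) (l := l) (b := b + k + 1) (by
      rintro l₁ x l₂ rfl
      have h₁ := hneed l₁ fun y hy => hwins' y (by simp [hy])
      have h₂ := hlose l₁ fun y hy => hlosses' y (by simp [hy])
      have h₃ := sum_losses_le (List.nodup_append.1 h).1 log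
      have h₄ := hcross (· ∈ l₁) (pairwise_mem_of_nodup_append h)
      simp only [List.length_nil]
      omega)
  obtain ⟨h₁, h₂⟩ := pairUp_length (need := fun x => k + 1 - wins log x)
    (lose := fun x => k + 1 - losses log x) (pool := []) (l := l)
  have h₃ := hneed l hwins'
  have h₄ := hlose l hlosses'
  rw [sum_wins h, List.countP_eq_length.2
    (fun c hc => by simpa using (mem_of_pair_sublist (hlog c hc)).2)] at h₃
  rw [sum_losses h, List.countP_eq_length.2
    (fun c hc => by simpa using (mem_of_pair_sublist (hlog c hc)).1)] at h₄
  simp only [completion, List.length_append, List.length_map]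
  simp only [List.length_nil] at h₂
  have h₅ := List.length_filter_le (fun x => decide (x ≠ l.headD d))
    (pairUp (fun x => k + 1 - wins log x) (fun x => k + 1 - losses log x) [] l).2.1
  have h₆ := List.length_filter_le (fun x => decide (x ≠ l.reverse.headD d))
    (pairUp (fun x => k + 1 - wins log x) (fun x => k + 1 - losses log x) [] l).2.2
  omega

/-! ### Certifying the candidates of one group. -/

/-- Ask whether `x < y` for all pairs `(x, y)` in the list, until some answer is negative. -/
def askAll : List (X × X) → Prog X Bool
  | [] => ret true
  | c :: l => (less c.1 c.2).bind fun
    | true => askAll l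
    | false => ret false

theorem outcome_askAll {l : List (X × X)} (hl : ∀ c ∈ l, c.1 ≠ c.2) {log : List (X × X)} {b : Bool}
    (h : (askAll l).Outcome log b) :
    log.length ≤ l.length ∧ (b = true → log = l) ∧
      (b = false → ∃ c ∈ l, (c.2, c.1) ∈ log) := by
  induction l generalizing log with
  | nil =>
    obtain ⟨rfl, rfl⟩ := outcome_ret h
    simp
  | cons c l ih =>
    obtain ⟨a, l₁, l₂, h₁, h₂, rfl⟩ := outcome_bind h
    rcases outcome_less (hl c (by simp)) h₁ with ⟨rfl, rfl⟩ | ⟨rfl, rfl⟩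
    · obtain ⟨g₁, g₂, g₃⟩ := ih (fun c hc => hl c (by simp [hc])) h₂
      refine ⟨by simp; omega, fun hb => by rw [g₂ hb]; rfl, fun hb => ?_⟩
      obtain ⟨c', h, h'⟩ := g₃ hb
      exact ⟨c', by simp [h], by simp [h']⟩
    · obtain ⟨rfl, rfl⟩ := outcome_ret h₂
      exact ⟨by simp, by simp, fun _ => ⟨c, by simp, by simp⟩⟩

/-- Sort the elements of `l` and verify that only the first can be the minimum and only the last
can be the maximum; return these two elements, or `none` if the answers are contradictory. -/
def certify (k p : ℕ) (d : X) (l : List X) : Prog X (Option (X × X)) :=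
  (sort p l).withLog.bind fun r =>
    (askAll (completion k d r.2 r.1)).bind fun b =>
      ret (if b then some (r.1.headD d, r.1.reverse.headD d) else none)

theorem outcome_certify {k p : ℕ} {d : X} {l : List X} (hl : l.length ≤ 2 ^ p) (hnd : l.Nodup)
    (hk : 6 * 2 ^ p ≤ k + 7) {log : List (X × X)} {o : Option (X × X)}
    (h : (certify k p d l).Outcome log o) :
    log.length ≤ (k + 1) * l.length + 2 * (k + 1) ∧
      (∀ R : X → X → Prop, (∀ x y z, R x y → R y z → R x z) → (∀ x, ¬ R x x) → o = none →
        ∃ c ∈ log, ¬ R c.1 c.2) ∧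
      ∀ m M, o = some (m, M) → ∀ x ∈ l, (x ≠ m → k + 1 ≤ wins log x) ∧
        (x ≠ M → k + 1 ≤ losses log x) := by
  obtain ⟨⟨s, log'⟩, l₁, l₂, h₁, g₁, rfl⟩ := outcome_bind h
  obtain ⟨b, l₃, l₄, h₂, h₃, rfl⟩ := outcome_bind g₁
  obtain ⟨rfl, rfl⟩ := outcome_ret h₃
  obtain ⟨e, h₁⟩ := outcome_withLog h₁
  simp only at e h₁ h₂ ⊢
  subst e
  obtain ⟨hperm, hsub, hcross, hsort⟩ := outcome_sort hl hnd h₁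
  have hs := hperm.nodup_iff.2 hnd
  obtain ⟨u₁, u₂, u₃⟩ := outcome_askAll (completion_ne hs) h₂
  rw [List.append_nil]
  refine ⟨?_, ?_, ?_⟩
  -- The crossing bound is taken as `b = k + 1`; it holds because the sort crosses a cut at most `6
  -- * 2 ^ p - 6` times.
  · have := length_completion_le (k := k) (d := d) hs le_rfl hsub fun S _ hS => by
      have := hcross S hS
      omega
    rw [hperm.length_eq] at this
    rw [List.length_append]
    omega
  · intro R htr hirr ho
    by_contra! hc
    have hR := hsort R htr fun c h => hc c (by simp [h])
    have hb : b = false := by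
      cases b <;> simp at ho ⊢
    obtain ⟨c, h, h'⟩ := u₃ hb
    -- The refuted pair is true by the sorted order, while its reversal would be true as an answer.
    exact hirr _ (htr _ _ _ (completion_rel hR c h) (hc (c.2, c.1) (by simp [h'])))
  · intro m M ho x hx
    cases b with
    | false => simp at ho
    | true =>
      simp only [if_true, Option.some.injEq, Prod.mk.injEq] at ho
      rw [u₂ rfl, ← ho.1, ← ho.2]
      exact ⟨wins_completion hs (hperm.mem_iff.2 hx), losses_completion hs (hperm.mem_iff.2 hx)⟩

end Prog

/-! ### Counting lies, and retrying failed groups. -/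

namespace Prog

variable {X α : Type}

/-- The number of answers in `log` that are false for the order `R`. -/
def falseCount (R : X → X → Prop) [DecidableRel R] (log : List (X × X)) : ℕ :=
  log.countP fun c => ¬ R c.1 c.2

section

variable {R : X → X → Prop} [DecidableRel R]

theorem falseCount_append (l₁ l₂ : List (X × X)) :
    falseCount R (l₁ ++ l₂) = falseCount R l₁ + falseCount R l₂ := List.countP_append

theorem falseCount_pos {log : List (X × X)} (h : ∃ c ∈ log, ¬ R c.1 c.2) :
    1 ≤ falseCount R log :=
  List.countP_pos_iff.2 (by simpa using h)

theorem wins_le_falseCount [DecidableEq X] {g : X} (hg : ∀ y, ¬ R y g) (log : List (X × X)) :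
    wins log g ≤ falseCount R log := by
  refine List.countP_mono_left fun c _ hc => ?_
  have hc : c.2 = g := by simpa using hc
  simpa [hc] using hg c.1

theorem losses_le_falseCount [DecidableEq X] {g : X} (hg : ∀ y, ¬ R g y) (log : List (X × X)) :
    losses log g ≤ falseCount R log := by
  refine List.countP_mono_left fun c _ hc => ?_
  have hc : c.1 = g := by simpa using hc
  simpa [hc] using hg c.2

end

/-- Run `p` until it succeeds, at most `f` times. -/
def retry (p : Prog X (Option α)) (d : α) : ℕ → Prog X α
  | 0 => ret d
  | f + 1 => p.bind fun
    | some a => ret a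
    | none => retry p d f

/-- Every failed attempt uses up a lie of its own, so fuel exceeding the number of lies never runs
out and `d` is not returned as a default. -/
theorem outcome_retry {R : X → X → Prop} [DecidableRel R] {p : Prog X (Option α)} {d : α} {b : ℕ}
    (hp : ∀ log o, p.Outcome log o → log.length ≤ b ∧ (o = none → 1 ≤ falseCount R log))
    {f : ℕ} {log : List (X × X)} {a : α} (h : (retry p d f).Outcome log a)
    (hf : falseCount R log < f) :
    log.length ≤ b + falseCount R log * b ∧
      ∃ log', p.Outcome log' (some a) ∧ falseCount R log' ≤ falseCount R log := by
  induction f generalizing log with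
  | zero => omega
  | succ f ih =>
    obtain ⟨o, l₁, l₂, h₁, h₂, rfl⟩ := outcome_bind h
    obtain ⟨hb, hn⟩ := hp _ _ h₁
    rw [falseCount_append] at hf ⊢
    cases o with
    | some a' =>
      obtain ⟨rfl, rfl⟩ := outcome_ret h₂
      refine ⟨?_, l₁, h₁, by omega⟩
      rw [List.append_nil]
      omega
    | none =>
      have := hn rfl
      obtain ⟨hb', log', ho, hle⟩ := ih h₂ (by omega)
      refine ⟨?_, log', ho, by omega⟩
      rw [List.length_append]
      nlinarith

variable [DecidableEq X]

/-- Reduce each group to a candidate for the minimum and a candidate for the maximum. -/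
def reduce (k p : ℕ) (d : X) : List (List X) → Prog X (List (X × X))
  | [] => ret []
  | g :: gs => (retry (certify k p d g) (d, d) (k + 1)).bind fun a =>
      (reduce k p d gs).bind fun r => ret (a :: r)

/-- A true minimum rejected by its group would have `k + 1` wins in the successful attempt, all of
them lies; dually for the maximum. -/
theorem outcome_reduce {R : X → X → Prop} [DecidableRel R] (htr : ∀ x y z, R x y → R y z → R x z)
    (hirr : ∀ x, ¬ R x x) {k p : ℕ} (hk : 6 * 2 ^ p ≤ k + 7) {d : X} {gs : List (List X)}
    (hgs : ∀ g ∈ gs, g.length ≤ 2 ^ p ∧ g.Nodup) {log : List (X × X)} {r : List (X × X)}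
    (h : (reduce k p d gs).Outcome log r) (hlies : falseCount R log ≤ k) :
    r.length = gs.length ∧
      log.length ≤ (k + 1) * gs.flatten.length + 2 * (k + 1) * gs.length +
        falseCount R log * ((k + 1) * 2 ^ p + 2 * (k + 1)) ∧
      ∀ x ∈ gs.flatten, ((∀ y, ¬ R y x) → x ∈ r.map Prod.fst) ∧
        ((∀ y, ¬ R x y) → x ∈ r.map Prod.snd) := by
  induction gs generalizing log r with
  | nil =>
    obtain ⟨rfl, rfl⟩ := outcome_ret h
    simp
  | cons g gs ih =>
    obtain ⟨a, l₁, l', h₁, h', rfl⟩ := outcome_bind h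
    obtain ⟨r', l₂, l₃, h₂, h₃, rfl⟩ := outcome_bind h'
    obtain ⟨rfl, rfl⟩ := outcome_ret h₃
    rw [List.append_nil] at *
    rw [falseCount_append] at hlies ⊢
    obtain ⟨hr, hlen, hmem⟩ := ih (fun g' hg' => hgs g' (by simp [hg'])) h₂ (by omega)
    obtain ⟨hg, hnd⟩ := hgs g (by simp)
    obtain ⟨hlen₁, log', ho, hle⟩ := outcome_retry (R := R)
      (b := (k + 1) * g.length + 2 * (k + 1)) (fun log o ho => by
        obtain ⟨u₁, u₂, -⟩ := outcome_certify hg hnd hk ho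
        exact ⟨u₁, fun hn => falseCount_pos (u₂ R htr hirr hn)⟩) h₁ (by omega)
    obtain ⟨-, -, hc⟩ := outcome_certify hg hnd hk ho
    refine ⟨by simp [hr], ?_, ?_⟩
    · simp only [List.length_append, List.flatten_cons, List.length_cons]
      have : falseCount R l₁ * ((k + 1) * g.length + 2 * (k + 1)) ≤
          falseCount R l₁ * ((k + 1) * 2 ^ p + 2 * (k + 1)) := by gcongr
      linarith
    · intro x hx
      rw [List.flatten_cons, List.mem_append] at hx
      simp only [List.map_cons, List.mem_cons]
      rcases hx with hx | hx
      · obtain ⟨hm, hM⟩ := hc a.1 a.2 rfl x hx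
        refine ⟨fun hg => .inl ?_, fun hg => .inl ?_⟩
        · by_contra hne
          have := wins_le_falseCount hg log'
          have := hm hne
          omega
        · by_contra hne
          have := losses_le_falseCount hg log'
          have := hM hne
          omega
      · exact ⟨fun hg => .inr ((hmem x hx).1 hg), fun hg => .inr ((hmem x hx).2 hg)⟩

/-! ### Majority tournament among the candidates. -/

/-- Ask `n` times whether `x < y`, and count the positive answers. -/
def countLess (x y : X) : ℕ → Prog X ℕ
  | 0 => ret 0
  | n + 1 => (less x y).bind fun b => (countLess x y n).bind fun r => ret (r + b.toNat)

theorem outcome_countLess {x y : X} (hxy : x ≠ y) {n : ℕ} {log : List (X × X)} {r : ℕ}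
    (h : (countLess x y n).Outcome log r) :
    log.length = n ∧ wins log y = r ∧ losses log x = r ∧ wins log x + r = n ∧
      losses log y + r = n := by
  induction n generalizing log r with
  | zero =>
    obtain ⟨rfl, rfl⟩ := outcome_ret h
    simp [wins, losses]
  | succ n ih =>
    obtain ⟨b, l₁, l', h₁, h', rfl⟩ := outcome_bind h
    obtain ⟨r', l₂, l₃, h₂, h₃, rfl⟩ := outcome_bind h'
    obtain ⟨rfl, rfl⟩ := outcome_ret h₃
    obtain ⟨u₁, u₂, u₃, u₄, u₅⟩ := ih h₂
    simp only [wins, losses] at u₂ u₃ u₄ u₅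
    rcases outcome_less hxy h₁ with ⟨rfl, rfl⟩ | ⟨rfl, rfl⟩ <;>
      simp [wins, losses, hxy, hxy.symm] <;> omega

theorem outcome_countLess_self {x : X} {n : ℕ} {log : List (X × X)} {r : ℕ}
    (h : (countLess x x n).Outcome log r) : log = [] := by
  induction n generalizing log r with
  | zero => exact (outcome_ret h).1
  | succ n ih =>
    obtain ⟨b, l₁, l', h₁, h', rfl⟩ := outcome_bind h
    obtain ⟨r', l₂, l₃, h₂, h₃, rfl⟩ := outcome_bind h'
    rw [outcome_less_self h₁, ih h₂, (outcome_ret h₃).1]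
    rfl

/-- The smaller and the larger of `x` and `y` by the majority of `2 * k + 1` answers. -/
def majority (k : ℕ) (x y : X) : Prog X (X × X) :=
  (countLess x y (2 * k + 1)).bind fun r => ret (if k < r then (x, y) else (y, x))

theorem outcome_majority {R : X → X → Prop} [DecidableRel R] {k : ℕ} {x y : X}
    {log : List (X × X)} {r : X × X} (h : (majority k x y).Outcome log r) :
    log.length ≤ 2 * k + 1 ∧ (falseCount R log ≤ k → ∀ g, g = x ∨ g = y →
      ((∀ z, ¬ R z g) → r.1 = g) ∧ ((∀ z, ¬ R g z) → r.2 = g)) := by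
  obtain ⟨n, l₁, l₂, h₁, h₂, rfl⟩ := outcome_bind h
  obtain ⟨rfl, rfl⟩ := outcome_ret h₂
  rw [List.append_nil]
  by_cases hxy : x = y
  · subst hxy
    rw [outcome_countLess_self h₁]
    refine ⟨by simp, fun _ g hg => ?_⟩
    have : g = x := by tauto
    simp [this]
  · obtain ⟨u₁, u₂, u₃, u₄, u₅⟩ := outcome_countLess hxy h₁
    refine ⟨u₁.le, fun hf g hg => ⟨fun hm => ?_, fun hM => ?_⟩⟩
    · have := wins_le_falseCount hm l₁
      rcases hg with rfl | rfl
      · rw [if_pos (by omega)]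
      · rw [if_neg (by omega)]
    · have := losses_le_falseCount hM l₁
      rcases hg with rfl | rfl
      · rw [if_neg (by omega)]
      · rw [if_pos (by omega)]

/-- Replace the current candidate `x` by the winner, selected by `f`, of a majority comparison
with each list element in turn. -/
def tournament (k : ℕ) (f : X × X → X) : X → List X → Prog X X
  | x, [] => ret x
  | x, y :: l => (majority k x y).bind fun r => tournament k f (f r) l

theorem length_tournament_le {k : ℕ} {f : X × X → X} {x : X} {l : List X} {log : List (X × X)}
    {r : X} (h : (tournament k f x l).Outcome log r) : log.length ≤ (2 * k + 1) * l.length := by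
  induction l generalizing x log r with
  | nil =>
    obtain ⟨rfl, rfl⟩ := outcome_ret h
    simp
  | cons y l ih =>
    obtain ⟨a, l₁, l₂, h₁, h₂, rfl⟩ := outcome_bind h
    have := ih h₂
    have := (outcome_majority (R := Eq) h₁).1
    rw [List.length_append, List.length_cons, Nat.mul_succ]
    omega

theorem outcome_tournament {R : X → X → Prop} [DecidableRel R] {k : ℕ} {f : X × X → X} {g : X}
    (hf : ∀ x y log r, (majority k x y).Outcome log r → falseCount R log ≤ k →
      g = x ∨ g = y → f r = g)
    {x : X} {l : List X} {log : List (X × X)} {r : X} (h : (tournament k f x l).Outcome log r)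
    (hlies : falseCount R log ≤ k) (hg : g = x ∨ g ∈ l) : r = g := by
  induction l generalizing x log r with
  | nil =>
    obtain ⟨rfl, rfl⟩ := outcome_ret h
    exact (hg.resolve_right List.not_mem_nil).symm
  | cons y l ih =>
    obtain ⟨a, l₁, l₂, h₁, h₂, rfl⟩ := outcome_bind h
    rw [falseCount_append] at hlies
    rw [List.mem_cons, ← or_assoc] at hg
    exact ih h₂ (by omega) (hg.imp_left fun hg => (hf _ _ _ _ h₁ (by omega) hg).symm)

/-- Find the minimum and the maximum by reducing the groups `gs` to candidates. -/
def minMax (k p : ℕ) (d : X) (gs : List (List X)) : Prog X (X × X) :=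
  (reduce k p d gs).bind fun r =>
    (tournament k Prod.fst d (r.map Prod.fst)).bind fun m =>
      (tournament k Prod.snd d (r.map Prod.snd)).bind fun M => ret (m, M)

theorem outcome_minMax {R : X → X → Prop} [DecidableRel R] (htr : ∀ x y z, R x y → R y z → R x z)
    (hirr : ∀ x, ¬ R x x) {k p : ℕ} (hk : 6 * 2 ^ p ≤ k + 7) {d : X} {gs : List (List X)}
    (hgs : ∀ g ∈ gs, g.length ≤ 2 ^ p ∧ g.Nodup) {log : List (X × X)} {r : X × X}
    (h : (minMax k p d gs).Outcome log r) (hlies : falseCount R log ≤ k) :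
    log.length ≤ (k + 1) * gs.flatten.length + 6 * (k + 1) * gs.length +
        k * ((k + 1) * 2 ^ p + 2 * (k + 1)) ∧
      ∀ x ∈ gs.flatten, ((∀ y, ¬ R y x) → r.1 = x) ∧ ((∀ y, ¬ R x y) → r.2 = x) := by
  obtain ⟨s, l₁, l', h₁, h', rfl⟩ := outcome_bind h
  obtain ⟨m, l₂, l'', h₂, h'', rfl⟩ := outcome_bind h'
  obtain ⟨M, l₃, l₄, h₃, h₄, rfl⟩ := outcome_bind h''
  obtain ⟨rfl, rfl⟩ := outcome_ret h₄
  rw [List.append_nil, falseCount_append, falseCount_append] at hlies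
  obtain ⟨hs, hlen, hmem⟩ := outcome_reduce htr hirr hk hgs h₁ (by omega)
  have h₂' := length_tournament_le h₂
  have h₃' := length_tournament_le h₃
  refine ⟨?_, fun x hx => ⟨fun hm => ?_, fun hM => ?_⟩⟩
  · rw [List.length_map, hs] at h₂' h₃'
    have : falseCount R l₁ * ((k + 1) * 2 ^ p + 2 * (k + 1)) ≤
        k * ((k + 1) * 2 ^ p + 2 * (k + 1)) := by
      gcongr
      omega
    simp only [List.length_append, List.length_nil]
    nlinarith
  · exact outcome_tournament (fun a b log r ho hle hg => ((outcome_majority ho).2 hle x hg).1 hm)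
      h₂ (by omega) (.inr ((hmem x hx).1 hm))
  · exact outcome_tournament (fun a b log r ho hle hg => ((outcome_majority ho).2 hle x hg).2 hM)
      h₃ (by omega) (.inr ((hmem x hx).2 hM))

/-! ### Grouping and the choice of constants. -/

omit [DecidableEq X] in
theorem exists_groups {s : ℕ} (hs : 0 < s) (l : List X) :
    ∃ gs : List (List X), gs.flatten = l ∧ (∀ g ∈ gs, g.length ≤ s) ∧
      gs.length * s ≤ l.length + (s - 1) := by
  induction hn : l.length using Nat.strong_induction_on generalizing l with
  | _ n ih =>
    rcases lt_or_ge l.length s with hl | hl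
    · by_cases hl₀ : l = []
      · exact ⟨[], by simp [hl₀]⟩
      · have := List.length_pos_iff.2 hl₀
        exact ⟨[l], by simp, by simpa using hl.le, by simp; omega⟩
    · obtain ⟨gs, hf, hg, hlen⟩ := ih (l.drop s).length
        (by rw [List.length_drop]; omega) (l.drop s) rfl
      refine ⟨l.take s :: gs, by simp [hf], ?_, ?_⟩
      · simp only [List.mem_cons]
        rintro g (rfl | h)
        · simp
        · exact hg g h
      · rw [List.length_drop] at hlen
        rw [List.length_cons, Nat.succ_mul]
        omega

theorem findsMinMax_minMax [Finite X] {k p : ℕ} (hk : 6 * 2 ^ p ≤ k + 7) (d : X)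
    {gs : List (List X)} (hgs : ∀ g ∈ gs, g.length ≤ 2 ^ p ∧ g.Nodup)
    (hmem : ∀ x, x ∈ gs.flatten) :
    (minMax k p d gs).toStrategy.FindsMinMax k ((k + 1) * gs.flatten.length +
      6 * (k + 1) * gs.length + k * ((k + 1) * 2 ^ p + 2 * (k + 1))) := by
  intro _ lies queries m M hrun hlies
  obtain ⟨log, ho, rfl, rfl⟩ := outcome_of_run hrun
  have : Nonempty X := ⟨d⟩
  obtain ⟨hcost, h⟩ := outcome_minMax (R := (· < ·)) (fun _ _ _ => lt_trans) lt_irrefl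
    hk hgs ho hlies
  obtain ⟨a, ha⟩ := Finite.exists_min (id : X → X)
  obtain ⟨b, hb⟩ := Finite.exists_max (id : X → X)
  have hm : m = a := (h a (hmem a)).1 fun y => not_lt_of_ge (ha y)
  have hM : M = b := (h b (hmem b)).2 fun y => not_lt_of_ge (hb y)
  exact ⟨hcost, hm ▸ ha, hM ▸ hb⟩

end Prog

theorem exists_findsMinMax (k n : ℕ) (hn : 0 < n) :
    ∃ T : Strategy (Fin n), T.FindsMinMax k ((k + 1 + 72) * n + 100 * k ^ 3) := by
  -- The group size is about `k / 6` up to a factor of two: small enough for the crossing bound,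
  -- large enough that `(k + 1) / 2 ^ p ≤ 12`, whence `72 = 6 * 12`.
  obtain ⟨p, hp, hp'⟩ : ∃ p, 6 * 2 ^ p ≤ k + 6 ∧ k + 1 ≤ 12 * 2 ^ p := by
    refine ⟨Nat.log 2 ((k + 1) / 6), ?_, ?_⟩
    · by_cases h : (k + 1) / 6 = 0
      · rw [h]; simp
      · have := Nat.pow_log_le_self 2 h
        omega
    · have := Nat.lt_pow_succ_log_self one_lt_two ((k + 1) / 6)
      rw [pow_succ] at this
      omega
  obtain ⟨gs, hflat, hgs, hlen⟩ := Prog.exists_groups (show 0 < 2 ^ p by positivity)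
    (List.finRange n)
  have hgs' : ∀ g ∈ gs, g.length ≤ 2 ^ p ∧ g.Nodup := fun g hg =>
    ⟨hgs g hg, (List.nodup_flatten.1 (hflat ▸ List.nodup_finRange n)).1 g hg⟩
  refine ⟨(Prog.minMax k p ⟨0, hn⟩ gs).toStrategy, fun lies queries m M hrun hlies => ?_⟩
  obtain ⟨hcost, hm, hM⟩ := Prog.findsMinMax_minMax (by omega) ⟨0, hn⟩ hgs'
    (fun x => hflat ▸ List.mem_finRange x) lies queries m M hrun hlies
  refine ⟨hcost.trans ?_, hm, hM⟩
  rw [hflat, List.length_finRange]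
  rw [List.length_finRange] at hlen
  clear hgs hgs' hflat
  generalize 2 ^ p = s at *
  have h₁ : 6 * (k + 1) * gs.length ≤ 72 * n + 72 * (s - 1) :=
    calc 6 * (k + 1) * gs.length ≤ 6 * (12 * s) * gs.length := by gcongr
      _ = 72 * (gs.length * s) := by ring
      _ ≤ 72 * n + 72 * (s - 1) := by omega
  -- This uses the sharper `6 * s ≤ k + 6`; for `k = 0` it forces `s = 1`, so the rounding in the
  -- number of groups costs nothing.
  have h₂ : 72 * (s - 1) ≤ 12 * k := by omega
  rcases Nat.eq_zero_or_pos k with rfl | hk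
  · omega
  have h₃ : k ≤ k ^ 3 := Nat.le_self_pow (by norm_num) k
  have h₄ : k * ((k + 1) * s + 2 * (k + 1)) ≤ k * ((2 * k) * (2 * k) + 2 * (2 * k) * k) := by
    have : 2 * (k + 1) ≤ 2 * (2 * k) * k := by nlinarith
    gcongr <;> omega
  have h₅ : k * ((2 * k) * (2 * k) + 2 * (2 * k) * k) = 8 * k ^ 3 := by ring
  linarith

theorem theorem1 :
    ∃ (C D : ℕ) (A : (k n : ℕ) → 0 < n → Strategy (Fin n)),
      ∀ (k n : ℕ) (hn : 0 < n),
        (A k n hn).FindsMinMax k ((k + 1 + C) * n + D * k ^ 3) := by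
  choose A hA using exists_findsMinMax
  exact ⟨72, 100, A, hA⟩
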